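/- **Theorem (Efficiency).** Let $\Omega\subset\mathbb R^2$ be a simply connected bounded polygonal Lipschitz domain, $\|\cdot\|$ the norm and $(\cdot,\cdot)$ the scalar product of $L^2(\Omega)$. Consider coefficients $\mathbf A:\Omega\to\mathbb R^{2\times2}_{sym}$, $\mathbf b:\Omega\to\mathbb R^2$, $\gamma:\Omega\to\mathbb R$ such that (A1) there are $0<\alpha\le\Lambda$ with $\alpha|\xi|^2\le \mathbf A(x)\xi\cdot\xi\le\Lambda|\xi|^2$ for a.e. $x\in\Omega$ and all $\xi\in\mathbb R^2$, and $\mathbf A,\mathbf b,\gamma$ are Lipschitz continuous; (A2) for each $f\in L^2(\Omega)$ there is a unique weak solution $u\in H^1_0(\Omega)$ of $-\nabla\cdot(\mathbf A\nabla u+u\mathbf b)+\gamma u=f$, that is, $(\mathbf A\nabla u+u\mathbf b,\nabla v)+(\gamma u,v)=(f,v)$ for all $v\in H^1_0(\Omega)$. Let $f\in L^2(\Omega)$, let $u$ be the weak solution, and set $\mathbf p:=-(\mathbf A\nabla u+u\mathbf b)$ and $\mathbf b^*:=\mathbf A^{-1}\mathbf b$. Let $\mathcal T$ be a regular triangulation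 of $\Omega$ into closed triangles, $h_{\mathcal T}|_T:=h_T:=\operatorname{diam}T$, and suppose that each $T\in\mathcal T$ contains a disc of radius $h_T/\kappa$ (shape regularity). Let $\Pi_0$ be the $L^2$ projection onto the space $P_0(\mathcal T)$ of piecewise constants, and $\mathbf A_h:=\Pi_0\mathbf A$, $\mathbf b_h:=\Pi_0\mathbf b$, $\gamma_h:=\Pi_0\gamma$, $f_h:=\Pi_0f$, $\mathbf b_h^*:=\mathbf A_h^{-1}\mathbf b_h$. Let $RT_0(\mathcal T)$ be the space of $\mathbf q\in H(\mathrm{div},\Omega)$ with $\mathbf q(x)=\mathbf c_T+d_Tx$ on each $T\in\mathcal T$ and continuous normal components across interior edges, and let $(\mathbf p_M,u_M)\in RT_0(\mathcal T)\times P_0(\mathcal T)$ satisfy $$(\mathbf A_h^{-1}\mathbf p_M+u_M\mathbf b_h^*,\mathbf q)-(\operatorname{div}\mathbf q,u_M)=0\quad\text{for all }\mathbf q\in RT_0(\mathcal T),$$ $$(\operatorname{div}\mathbf p_M,v_h)+(\gamma_hu_M,v_h)=(f_h,v_h)\quad\text{for all }v_h\in P_0(\mathcal T).$$ Then the minimum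 below is attained and $$\min_{v\in H^1_0(\Omega)}\|\mathbf A_h^{-1}\mathbf p_M+u_M\mathbf b_h^*-\nabla v\|+\|h_{\mathcal T}(\mathbf A_h^{-1}\mathbf p_M+u_M\mathbf b_h^*)\|$$ $$\le C\Big(\|u-u_M\|+\|\mathbf p-\mathbf p_M\|+\|(\mathbf A^{-1}-\mathbf A_h^{-1})\mathbf p_M\|+\|u_M(\mathbf b^*-\mathbf b_h^*)\|\Big),$$ where the constant $C$ depends only on $\Omega$, the shape regularity constant $\kappa$, the ellipticity constant $\alpha$ and an upper bound $\beta$ of $|\mathbf b|$ on $\Omega$; it is independent of the mesh-size, of $f$ and of $u$. -/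

import Mathlib

open MeasureTheory Set Filter Topology
open scoped NNReal ENNReal ContDiff Matrix

noncomputable section

namespace MixedFEM

/-- The Euclidean plane. -/
abbrev Plane := EuclideanSpace ℝ (Fin 2)

/-! ### Domains -/

/-- Lipschitz boundary: near each boundary point, after a linear isometry of the plane, `Ω` is the
part of the plane that lies strictly below the graph of a Lipschitz function. -/
def HasLipschitzBoundary (Ω : Set Plane) : Prop :=
  ∀ x ∈ frontier Ω, ∃ (e : Plane ≃ₗᵢ[ℝ] Plane) (r : ℝ) (K : ℝ≥0) (ψ : ℝ → ℝ),
    0 < r ∧ LipschitzWith K ψ ∧ ∀ y ∈ Metric.ball x r, (y ∈ Ω ↔ e y 1 < ψ (e y 0))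

/-- Simply connected bounded polygonal Lipschitz domain in the plane. -/
structure IsPolygonalLipschitzDomain (Ω : Set Plane) : Prop where
  isOpen : IsOpen Ω
  bounded : Bornology.IsBounded Ω
  simplyConnected : SimplyConnectedSpace Ω
  polygonal : ∃ S : Finset (Plane × Plane), frontier Ω = ⋃ s ∈ S, segment ℝ s.1 s.2
  lipschitz : HasLipschitzBoundary Ω

/-! ### Lebesgue and Sobolev spaces -/

/-- `f ∈ L²(Ω)`, for scalar or vector valued `f`. -/
def MemL2 {V : Type*} [NormedAddCommGroup V] (Ω : Set Plane) (f : Plane → V) : Prop :=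
  MemLp f 2 (volume.restrict Ω)

/-- The norm of `L²(Ω)`, for scalar or vector valued functions. -/
def l2norm {V : Type*} [NormedAddCommGroup V] (Ω : Set Plane) (f : Plane → V) : ℝ≥0∞ :=
  eLpNorm f 2 (volume.restrict Ω)

/-- The scalar product of `L²(Ω)`. -/
def l2inner (Ω : Set Plane) (f g : Plane → ℝ) : ℝ := ∫ x in Ω, f x * g x

/-- The scalar product of `L²(Ω; ℝ²)`. -/
def l2innerVec (Ω : Set Plane) (p q : Plane → Plane) : ℝ := ∫ x in Ω, inner ℝ (p x) (q x)

/-- Test functions: smooth with compact support in `Ω`. -/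
structure IsTest (Ω : Set Plane) (φ : Plane → ℝ) : Prop where
  smooth : ContDiff ℝ ∞ φ
  compact : HasCompactSupport φ
  support : tsupport φ ⊆ Ω

/-- `v ∈ H¹(Ω)` with weak gradient `∇v = g`. -/
structure MemH1 (Ω : Set Plane) (v : Plane → ℝ) (g : Plane → Plane) : Prop where
  memL2 : MemL2 Ω v
  grad_memL2 : MemL2 Ω g
  weak_grad : ∀ φ, IsTest Ω φ → ∀ i : Fin 2,
    ∫ x in Ω, v x * gradient φ x i = - ∫ x in Ω, g x i * φ x

/-- `v ∈ H¹₀(Ω)` with weak gradient `∇v = g`, where `H¹₀(Ω)` is the closure of the test functions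
in `H¹(Ω)`. -/
structure MemH10 (Ω : Set Plane) (v : Plane → ℝ) (g : Plane → Plane) : Prop where
  memH1 : MemH1 Ω v g
  approx : ∃ φ : ℕ → Plane → ℝ, (∀ n, IsTest Ω (φ n)) ∧
    Tendsto (fun n => l2norm Ω (fun x => φ n x - v x)) atTop (𝓝 0) ∧
    Tendsto (fun n => l2norm Ω (fun x => gradient (φ n) x - g x)) atTop (𝓝 0)

/-- `q` has the weak divergence `d ∈ L²(Ω)`. -/
structure HasWeakDiv (Ω : Set Plane) (q : Plane → Plane) (d : Plane → ℝ) : Prop where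
  memL2 : MemL2 Ω d
  weak_div : ∀ φ, IsTest Ω φ →
    ∫ x in Ω, inner ℝ (q x) (gradient φ x) = - ∫ x in Ω, d x * φ x

/-- `q ∈ H(div, Ω)`. -/
def MemHdiv (Ω : Set Plane) (q : Plane → Plane) : Prop :=
  MemL2 Ω q ∧ ∃ d, HasWeakDiv Ω q d

/-! ### The elliptic problem -/

/-- Matrix-vector product in the Euclidean plane. -/
def mulE (M : Matrix (Fin 2) (Fin 2) ℝ) (ξ : Plane) : Plane :=
  WithLp.toLp 2 (M *ᵥ ξ.ofLp)

/-- Assumption on the coefficients: `A` is symmetric and uniformly positive definite with bounds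
`a` and `L`, and `A`, `b`, `γ` are Lipschitz continuous on `Ω`. -/
structure CoeffAssumption (Ω : Set Plane) (A : Plane → Matrix (Fin 2) (Fin 2) ℝ)
    (b : Plane → Plane) (γ : Plane → ℝ) (a L : ℝ) : Prop where
  pos : 0 < a
  symm : ∀ᵐ x ∂volume.restrict Ω, (A x).IsSymm
  lower : ∀ᵐ x ∂volume.restrict Ω, ∀ ξ : Plane, a * ‖ξ‖ ^ 2 ≤ inner ℝ (mulE (A x) ξ) ξ
  upper : ∀ᵐ x ∂volume.restrict Ω, ∀ ξ : Plane, inner ℝ (mulE (A x) ξ) ξ ≤ L * ‖ξ‖ ^ 2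
  lipA : ∀ i j, ∃ K : ℝ≥0, LipschitzOnWith K (fun x => A x i j) Ω
  lipb : ∃ K : ℝ≥0, LipschitzOnWith K b Ω
  lipγ : ∃ K : ℝ≥0, LipschitzOnWith K γ Ω

/-- `u ∈ H¹₀(Ω)`, with `∇u = gu`, satisfies
`(A ∇u + u b, ∇v) + (γ u, v) = (f, v)` for all `v ∈ H¹₀(Ω)`. -/
structure IsWeakSolution (Ω : Set Plane) (A : Plane → Matrix (Fin 2) (Fin 2) ℝ)
    (b : Plane → Plane) (γ f u : Plane → ℝ) (gu : Plane → Plane) : Prop where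
  mem : MemH10 Ω u gu
  eqn : ∀ v gv, MemH10 Ω v gv →
    l2innerVec Ω (fun x => mulE (A x) (gu x) + u x • b x) gv
      + l2inner Ω (fun x => γ x * u x) v = l2inner Ω f v

/-- For each `f ∈ L²(Ω)` there is a unique (as an element of `L²(Ω)`) weak solution. -/
def WellPosed (Ω : Set Plane) (A : Plane → Matrix (Fin 2) (Fin 2) ℝ)
    (b : Plane → Plane) (γ : Plane → ℝ) : Prop :=
  ∀ f : Plane → ℝ, MemL2 Ω f →
    (∃ u gu, IsWeakSolution Ω A b γ f u gu) ∧
    ∀ u gu u' gu', IsWeakSolution Ω A b γ f u gu → IsWeakSolution Ω A b γ f u' gu' →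
      u =ᵐ[volume.restrict Ω] u'

/-- The flux `p = -(A ∇u + u b)`. -/
def flux (A : Plane → Matrix (Fin 2) (Fin 2) ℝ) (b : Plane → Plane)
    (u : Plane → ℝ) (gu : Plane → Plane) : Plane → Plane :=
  fun x => -(mulE (A x) (gu x) + u x • b x)

/-- `b* = A⁻¹ b`. -/
def bStar (A : Plane → Matrix (Fin 2) (Fin 2) ℝ) (b : Plane → Plane) : Plane → Plane :=
  fun x => mulE (A x)⁻¹ (b x)

/-! ### Triangulations and discrete spaces -/

/-- The closed triangle with the given vertices. -/
def hull (T : Finset Plane) : Set Plane := convexHull ℝ (T : Set Plane)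

/-- Regular (conforming) triangulation of `Ω` into finitely many nondegenerate closed triangles,
each given by its set of vertices. Two triangles meet in the convex hull of their common vertices:
they are disjoint, or share exactly one vertex, or exactly one edge, or coincide. -/
structure Triangulation (Ω : Set Plane) where
  triangles : Finset (Finset Plane)
  card_eq : ∀ T ∈ triangles, T.card = 3
  indep : ∀ T ∈ triangles, AffineIndependent ℝ (fun z : T => (z : Plane))
  conforming : ∀ T ∈ triangles, ∀ T' ∈ triangles,
    hull T ∩ hull T' = convexHull ℝ ((T : Set Plane) ∩ (T' : Set Plane))
  cover : ⋃ T ∈ triangles, hull T = closure Ω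

namespace Triangulation

variable {Ω : Set Plane}

/-- Shape regularity: each triangle `T` contains a disc of radius `diam T / κ`. -/
def ShapeRegular (𝒯 : Triangulation Ω) (κ : ℝ) : Prop :=
  ∀ T ∈ 𝒯.triangles, ∃ z, Metric.closedBall z (Metric.diam (hull T) / κ) ⊆ hull T

/-- The piecewise constant function with the value `c T` on (the interior of) each triangle `T`;
the edges are a null set and carry the value zero. -/
def piecewiseConst {V : Type*} [AddCommMonoid V] (𝒯 : Triangulation Ω) (c : Finset Plane → V) :
    Plane → V :=
  fun x => ∑ T ∈ 𝒯.triangles, (interior (hull T)).indicator (fun _ => c T) x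

/-- The mesh-size function `h_𝒯`. -/
def meshSize (𝒯 : Triangulation Ω) : Plane → ℝ :=
  𝒯.piecewiseConst fun T => Metric.diam (hull T)

/-- The `L²` projection `Π₀` onto piecewise constants (the mean value on each triangle). -/
def proj {V : Type*} [NormedAddCommGroup V] [NormedSpace ℝ V] (𝒯 : Triangulation Ω)
    (f : Plane → V) : Plane → V :=
  𝒯.piecewiseConst fun T => ⨍ y in hull T, f y

/-- `A_h = Π₀ A`, entry by entry. -/
def projMat (𝒯 : Triangulation Ω) (A : Plane → Matrix (Fin 2) (Fin 2) ℝ) :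
    Plane → Matrix (Fin 2) (Fin 2) ℝ :=
  fun x => Matrix.of fun i j => 𝒯.proj (fun y => A y i j) x

/-- `b_h* = A_h⁻¹ b_h`. -/
def bStarH (𝒯 : Triangulation Ω) (A : Plane → Matrix (Fin 2) (Fin 2) ℝ) (b : Plane → Plane) :
    Plane → Plane :=
  bStar (𝒯.projMat A) (𝒯.proj b)

/-- `v ∈ P₀(𝒯)`. -/
def MemP0 (𝒯 : Triangulation Ω) (v : Plane → ℝ) : Prop :=
  ∃ c : Finset Plane → ℝ, ∀ T ∈ 𝒯.triangles, ∀ᵐ x ∂volume.restrict (hull T), v x = c T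

/-- `q ∈ RT₀(𝒯)`: `q ∈ H(div, Ω)`, on each triangle `q(x) = c + d x`, and the normal components
agree on each common edge `[y, z]` of two triangles. -/
def MemRT0 (𝒯 : Triangulation Ω) (q : Plane → Plane) : Prop :=
  MemHdiv Ω q ∧ ∃ (c : Finset Plane → Plane) (d : Finset Plane → ℝ),
    (∀ T ∈ 𝒯.triangles, ∀ᵐ x ∂volume.restrict (hull T), q x = c T + d T • x) ∧
    ∀ T ∈ 𝒯.triangles, ∀ T' ∈ 𝒯.triangles, ∀ y ∈ T, ∀ z ∈ T, y ∈ T' → z ∈ T' → y ≠ z →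
      ∀ ν : Plane, inner ℝ ν (z - y) = 0 → ∀ x ∈ segment ℝ y z,
        inner ℝ (c T + d T • x) ν = inner ℝ (c T' + d T' • x) ν

/-- The function `A_h⁻¹ p_M + u_M b_h*`. -/
def residualField (𝒯 : Triangulation Ω) (A : Plane → Matrix (Fin 2) (Fin 2) ℝ)
    (b pM : Plane → Plane) (uM : Plane → ℝ) : Plane → Plane :=
  fun x => mulE (𝒯.projMat A x)⁻¹ (pM x) + uM x • 𝒯.bStarH A b x

/-- `(p_M, u_M) ∈ RT₀(𝒯) × P₀(𝒯)` solves the lowest-order Raviart-Thomas mixed finite element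
problem `(A_h⁻¹ p_M + u_M b_h*, q) - (div q, u_M) = 0` for all `q ∈ RT₀(𝒯)` and
`(div p_M, v) + (γ_h u_M, v) = (f_h, v)` for all `v ∈ P₀(𝒯)`. -/
structure IsMixedSolution (𝒯 : Triangulation Ω) (A : Plane → Matrix (Fin 2) (Fin 2) ℝ)
    (b : Plane → Plane) (γ f : Plane → ℝ) (pM : Plane → Plane) (uM : Plane → ℝ) : Prop where
  memRT0 : 𝒯.MemRT0 pM
  memP0 : 𝒯.MemP0 uM
  eqn₁ : ∀ q dq, 𝒯.MemRT0 q → HasWeakDiv Ω q dq →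
    l2innerVec Ω (𝒯.residualField A b pM uM) q - l2inner Ω dq uM = 0
  eqn₂ : ∀ dp, HasWeakDiv Ω pM dp → ∀ v, 𝒯.MemP0 v →
    l2inner Ω dp v + l2inner Ω (fun x => 𝒯.proj γ x * uM x) v = l2inner Ω (𝒯.proj f) v

end Triangulation

end MixedFEM

end

open MixedFEM

/-!
Write `r` for the residual field `A_h⁻¹ p_M + u_M b_h*`. As `(p_M, u_M)` lies in
`RT₀ × P₀` and the discrete coefficients are piecewise constant, `r` is affine and `u_M` is constant
on each triangle.

The minimum. By the Poincaré inequality the gradients of `H¹₀(Ω)` form a closed subspace of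
`L²(Ω; ℝ²)`, and the minimizer is an orthogonal projection (`exists_minimizer_memH10`). The
competitor `-u` shows that the minimum is at most `‖r + ∇u‖`. Since
`-∇u = A⁻¹ p + u b*`, the field `r + ∇u` is a combination of the four terms on the
right-hand side, with factors that depend on the ellipticity constant and the bound of `b` only
(`l2norm_residualField_add_le`).

The weighted term. On a triangle `T` of size `h`, let `η` be an even bump function about a point `c`,
with support of size comparable to `h` in `T`. As `r` is affine, the integral of `r η` is
`r(c) ∫ η`; on the other hand it is `∫ (r + ∇u) η + ∫ (u - u_M) ∇η`, where the constant `u_M` may be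
inserted as `∫ ∇η = 0`. This bounds `r(c)` for all `c` in a small disc, hence `r` on all of `T`, and
gives `h ‖r‖ ≤ C (h ‖r + ∇u‖ + ‖u - u_M‖)` on `T` (`exists_inverse_estimate`). The squares are summed
over the triangles (`exists_meshSize_estimate`), whose interiors are disjoint, lie in `Ω` because of
the Lipschitz boundary, and exhaust it up to a null set.
-/

namespace MixedFEM

/-! ### Test functions and the Poincaré inequality -/

variable {Ω : Set Plane}

lemma norm_gradient (φ : Plane → ℝ) (x : Plane) : ‖gradient φ x‖ = ‖fderiv ℝ φ x‖ :=
  LinearIsometryEquiv.norm_map _ _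

lemma gradient_apply (φ : Plane → ℝ) (x : Plane) (i : Fin 2) :
    gradient φ x i = fderiv ℝ φ x (EuclideanSpace.single i 1) := by
  have h := InnerProductSpace.toDual_symm_apply (𝕜 := ℝ) (E := Plane)
    (x := EuclideanSpace.single i 1) (y := fderiv ℝ φ x)
  rw [← h, EuclideanSpace.inner_single_right]
  simp [gradient]

namespace IsTest

variable {φ ψ : Plane → ℝ}

lemma differentiable (h : IsTest Ω φ) : Differentiable ℝ φ :=
  h.smooth.differentiable (by simp)

lemma gradient_add (hφ : IsTest Ω φ) (hψ : IsTest Ω ψ) :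
    gradient (φ + ψ) = gradient φ + gradient ψ := by
  ext1 x
  simp [gradient, fderiv_add (hφ.differentiable x) (hψ.differentiable x)]

lemma gradient_smul (hφ : IsTest Ω φ) (c : ℝ) :
    gradient (c • φ) = c • gradient φ := by
  ext1 x
  simp [gradient, fderiv_const_smul (hφ.differentiable x)]

lemma gradient_sub (hφ : IsTest Ω φ) (hψ : IsTest Ω ψ) :
    gradient (φ - ψ) = gradient φ - gradient ψ := by
  ext1 x
  simp [gradient, fderiv_sub (hφ.differentiable x) (hψ.differentiable x)]

protected lemma zero : IsTest Ω (0 : Plane → ℝ) :=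
  ⟨contDiff_const, HasCompactSupport.zero, by simp [tsupport]⟩

protected lemma add (hφ : IsTest Ω φ) (hψ : IsTest Ω ψ) : IsTest Ω (φ + ψ) :=
  ⟨hφ.smooth.add hψ.smooth, hφ.compact.add hψ.compact,
    (tsupport_add φ ψ).trans (union_subset hφ.support hψ.support)⟩

protected lemma smul (hφ : IsTest Ω φ) (c : ℝ) : IsTest Ω (c • φ) :=
  ⟨contDiff_const.smul hφ.smooth, hφ.compact.smul_left (f := fun _ => c),
    (tsupport_smul_subset_right (fun _ => c) φ).trans hφ.support⟩

protected lemma sub (hφ : IsTest Ω φ) (hψ : IsTest Ω ψ) : IsTest Ω (φ - ψ) := by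
  have := hφ.add (hψ.smul (-1))
  rwa [neg_one_smul, ← sub_eq_add_neg] at this

lemma continuous_fderiv (h : IsTest Ω φ) : Continuous (fderiv ℝ φ) :=
  h.smooth.continuous_fderiv (by simp)

lemma continuous_gradient (h : IsTest Ω φ) : Continuous (gradient φ) :=
  (LinearIsometryEquiv.continuous _).comp h.continuous_fderiv

lemma hasCompactSupport_gradient (h : IsTest Ω φ) : HasCompactSupport (gradient φ) :=
  (h.compact.fderiv ℝ).comp_left (map_zero _)

lemma support_gradient_subset (h : IsTest Ω φ) : Function.support (gradient φ) ⊆ Ω := by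
  intro x hx
  refine h.support (support_fderiv_subset ℝ (f := φ) ?_)
  rw [Function.mem_support, ← norm_ne_zero_iff] at hx ⊢
  rwa [← norm_gradient]

lemma memL2 (h : IsTest Ω φ) : MemL2 Ω φ :=
  (h.smooth.continuous.memLp_of_hasCompactSupport h.compact).restrict Ω

lemma memL2_gradient (h : IsTest Ω φ) : MemL2 Ω (gradient φ) :=
  (h.continuous_gradient.memLp_of_hasCompactSupport h.hasCompactSupport_gradient).restrict Ω

/-- Integration by parts, for two test functions. -/
lemma integral_mul_gradient (hφ : IsTest Ω φ) (hψ : IsTest Ω ψ) (i : Fin 2) :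
    ∫ x in Ω, φ x * gradient ψ x i = - ∫ x in Ω, gradient φ x i * ψ x := by
  have hs : ∀ f : Plane → ℝ, Function.support f ⊆ Ω → ∫ x in Ω, f x = ∫ x, f x :=
    fun f hf => setIntegral_eq_integral_of_forall_compl_eq_zero
      fun x hx => by_contra fun h => hx (hf h)
  have hsub : ∀ χ : Plane → ℝ, IsTest Ω χ → Function.support χ ⊆ Ω :=
    fun χ h => (subset_tsupport χ).trans h.support
  rw [hs _ ((Function.support_mul_subset_left _ _).trans (hsub φ hφ)),
    hs _ ((Function.support_mul_subset_right _ _).trans (hsub ψ hψ))]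
  simp_rw [gradient_apply]
  have hc : ∀ χ : Plane → ℝ, IsTest Ω χ → Continuous fun x => fderiv ℝ χ x
      (EuclideanSpace.single i 1) := fun χ h => h.continuous_fderiv.clm_apply continuous_const
  refine integral_mul_fderiv_eq_neg_fderiv_mul_of_integrable ?_ ?_ ?_
    (fun x _ => hφ.differentiable x) (fun x _ => hψ.differentiable x)
  · exact ((hc φ hφ).mul hψ.smooth.continuous).integrable_of_hasCompactSupport hψ.compact.mul_left
  · exact (hφ.smooth.continuous.mul (hc ψ hψ)).integrable_of_hasCompactSupport hφ.compact.mul_right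
  · exact (hφ.smooth.continuous.mul hψ.smooth.continuous).integrable_of_hasCompactSupport
      hφ.compact.mul_right

end IsTest

/-- Poincaré inequality for test functions on a bounded set. It is the Sobolev inequality
`‖φ‖_{L²} ≤ C ‖∇φ‖_{L¹}` of the plane, followed by Hölder's inequality. -/
theorem exists_poincare_constant (hΩ : Bornology.IsBounded Ω) :
    ∃ C : ℝ≥0, ∀ φ, IsTest Ω φ → l2norm Ω φ ≤ C * l2norm Ω (gradient φ) := by
  have hfin : volume Ω ≠ ⊤ := hΩ.measure_lt_top.ne
  refine ⟨eLpNormLESNormFDerivOfLeConst ℝ (volume : Measure Plane) Ω 1 2 *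
    ((volume Ω) ^ (1 / 2 : ℝ)).toNNReal, fun φ hφ => ?_⟩
  have h1 := eLpNorm_le_eLpNorm_fderiv_of_le (volume : Measure Plane) (u := φ) (s := Ω)
    (p := 1) (q := 2) (hφ.smooth.of_le (by simp)) ((subset_tsupport φ).trans hφ.support)
    le_rfl (by simp) (by norm_num) hΩ
  have h2 : eLpNorm (fderiv ℝ φ) 1 volume = eLpNorm (gradient φ) 1 (volume.restrict Ω) := by
    rw [eLpNorm_restrict_eq_of_support_subset hφ.support_gradient_subset]
    exact eLpNorm_congr_norm_ae (ae_of_all _ fun x => (norm_gradient φ x).symm)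
  have h3 : eLpNorm (gradient φ) 1 (volume.restrict Ω) ≤
      l2norm Ω (gradient φ) * (volume Ω) ^ (1 / 2 : ℝ) := by
    have := eLpNorm_le_eLpNorm_mul_rpow_measure_univ (p := 1) (q := 2)
      (μ := volume.restrict Ω) (f := gradient φ) (by norm_num)
      hφ.continuous_gradient.aestronglyMeasurable
    rw [Measure.restrict_apply_univ] at this
    convert this using 3
    · rfl
    · rw [ENNReal.toReal_one, ENNReal.toReal_ofNat]
      norm_num
  calc l2norm Ω φ ≤ eLpNorm φ 2 volume := eLpNorm_mono_measure _ Measure.restrict_le_self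
    _ ≤ eLpNormLESNormFDerivOfLeConst ℝ (volume : Measure Plane) Ω 1 2 *
        (l2norm Ω (gradient φ) * (volume Ω) ^ (1 / 2 : ℝ)) := by
      rw [ENNReal.coe_one, h2] at h1
      exact h1.trans (mul_le_mul_right h3 _)
    _ = _ := by
      rw [ENNReal.coe_mul, ENNReal.coe_toNNReal (by finiteness), mul_assoc,
        mul_comm (l2norm Ω _)]

/-! ### The distance to the gradients of `H¹₀(Ω)` is attained -/

/-- Testing against a fixed function of `L²` is continuous for the `L²` convergence. -/
lemma tendsto_setIntegral_mul_of_tendsto_l2norm {F : ℕ → Plane → ℝ} {f g : Plane → ℝ}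
    (hF : ∀ n, MemL2 Ω (F n)) (hf : MemL2 Ω f) (hg : MemL2 Ω g)
    (h : Tendsto (fun n => l2norm Ω (fun x => F n x - f x)) atTop (𝓝 0)) :
    Tendsto (fun n => ∫ x in Ω, F n x * g x) atTop (𝓝 (∫ x in Ω, f x * g x)) := by
  refine tendsto_integral_of_L1' _ (hf.integrable_mul hg).1
    (Eventually.of_forall fun n => (hF n).integrable_mul hg) ?_
  have hlim : Tendsto (fun n => l2norm Ω (fun x => F n x - f x) * l2norm Ω g) atTop (𝓝 0) := by
    have := ENNReal.Tendsto.mul_const h (Or.inr hg.2.ne)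
    rwa [zero_mul] at this
  refine tendsto_of_tendsto_of_tendsto_of_le_of_le tendsto_const_nhds hlim
    (fun n => zero_le) fun n => ?_
  have := eLpNorm_smul_le_mul_eLpNorm (p := 2) (q := 2) (r := 1) hg.1
    ((hF n).sub hf).1
  refine le_trans (eLpNorm_congr_ae (ae_of_all _ fun x => ?_)).le this
  simp [sub_mul]

lemma tendsto_l2norm_apply {F : ℕ → Plane → Plane} {f : Plane → Plane} (i : Fin 2)
    (h : Tendsto (fun n => l2norm Ω (fun x => F n x - f x)) atTop (𝓝 0)) :
    Tendsto (fun n => l2norm Ω (fun x => F n x i - f x i)) atTop (𝓝 0) :=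
  tendsto_of_tendsto_of_tendsto_of_le_of_le tendsto_const_nhds h (fun _ => zero_le)
    fun n => eLpNorm_mono fun x => PiLp.norm_apply_le (F n x - f x) i

lemma MemL2.apply {g : Plane → Plane} (hg : MemL2 Ω g) (i : Fin 2) : MemL2 Ω fun x => g x i :=
  hg.eval_piLp i

lemma memH10_of_tendsto {v : Plane → ℝ} {g : Plane → Plane} (hv : MemL2 Ω v) (hg : MemL2 Ω g)
    {φ : ℕ → Plane → ℝ} (hφ : ∀ n, IsTest Ω (φ n))
    (h₁ : Tendsto (fun n => l2norm Ω (fun x => φ n x - v x)) atTop (𝓝 0))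
    (h₂ : Tendsto (fun n => l2norm Ω (fun x => gradient (φ n) x - g x)) atTop (𝓝 0)) :
    MemH10 Ω v g := by
  refine ⟨⟨hv, hg, fun ψ hψ i => ?_⟩, φ, hφ, h₁, h₂⟩
  refine tendsto_nhds_unique (tendsto_setIntegral_mul_of_tendsto_l2norm
    (fun n => (hφ n).memL2) hv (hψ.memL2_gradient.apply i) h₁) ?_
  refine Tendsto.congr (fun n => ((hφ n).integral_mul_gradient hψ i).symm) ?_
  exact (tendsto_setIntegral_mul_of_tendsto_l2norm
    (fun n => (hφ n).memL2_gradient.apply i) (hg.apply i) hψ.memL2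
    (tendsto_l2norm_apply i h₂)).neg

/-- The gradients of test functions, as a subspace of `L²(Ω; ℝ²)`. -/
def testGradients (Ω : Set Plane) : Submodule ℝ (Lp Plane 2 (volume.restrict Ω)) where
  carrier := {G | ∃ φ, IsTest Ω φ ∧ G =ᵐ[volume.restrict Ω] gradient φ}
  zero_mem' := ⟨0, IsTest.zero, by
    filter_upwards [Lp.coeFn_zero Plane 2 (volume.restrict Ω)] with x hx
    exact hx.trans (by simp [gradient])⟩
  add_mem' := by
    rintro G H ⟨φ, hφ, hG⟩ ⟨ψ, hψ, hH⟩
    refine ⟨φ + ψ, hφ.add hψ, ?_⟩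
    rw [hφ.gradient_add hψ]
    exact (Lp.coeFn_add G H).trans (hG.add hH)
  smul_mem' := by
    rintro c G ⟨φ, hφ, hG⟩
    refine ⟨c • φ, hφ.smul c, ?_⟩
    rw [hφ.gradient_smul]
    exact (Lp.coeFn_smul c G).trans (hG.const_smul c)

lemma MemH10.toLp_mem {v : Plane → ℝ} {g : Plane → Plane} (h : MemH10 Ω v g) :
    h.memH1.grad_memL2.toLp g ∈ (testGradients Ω).topologicalClosure := by
  obtain ⟨φ, hφ, -, h₂⟩ := h.approx
  refine mem_closure_of_tendsto (f := fun n => (hφ n).memL2_gradient.toLp (gradient (φ n)))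
    (b := atTop) ?_ (Eventually.of_forall fun n => ⟨φ n, hφ n, MemLp.coeFn_toLp _⟩)
  exact (Lp.tendsto_Lp_iff_tendsto_eLpNorm'' _ _ _ _).2 h₂

/-- The gradients of `H¹₀(Ω)` are closed in `L²(Ω; ℝ²)`: by the Poincaré inequality, test functions
whose gradients converge form a Cauchy sequence. -/
lemma exists_memH10_of_mem_closure (hΩ : Bornology.IsBounded Ω)
    {G : Lp Plane 2 (volume.restrict Ω)} (hG : G ∈ (testGradients Ω).topologicalClosure) :
    ∃ v, MemH10 Ω v G := by
  obtain ⟨C, hC⟩ := exists_poincare_constant hΩ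
  obtain ⟨H, hH, hlim⟩ := mem_closure_iff_seq_limit.1 hG
  choose φ hφ hHφ using hH
  have hdist : ∀ m n, dist ((hφ m).memL2.toLp (φ m)) ((hφ n).memL2.toLp (φ n)) ≤
      C * dist (H m) (H n) := by
    intro m n
    have h1 : eLpNorm (⇑(H m) - ⇑(H n)) 2 (volume.restrict Ω)
        = l2norm Ω (gradient (φ m - φ n)) := by
      rw [(hφ m).gradient_sub (hφ n)]
      exact eLpNorm_congr_ae ((hHφ m).sub (hHφ n))
    have h2 : eLpNorm (⇑((hφ m).memL2.toLp (φ m)) - ⇑((hφ n).memL2.toLp (φ n))) 2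
        (volume.restrict Ω) = l2norm Ω (φ m - φ n) :=
      eLpNorm_congr_ae (((hφ m).memL2.coeFn_toLp).sub ((hφ n).memL2.coeFn_toLp))
    rw [Lp.dist_def, Lp.dist_def, h1, h2, ← ENNReal.coe_toReal, ← ENNReal.toReal_mul]
    refine ENNReal.toReal_mono (ENNReal.mul_ne_top ENNReal.coe_ne_top ?_)
      (hC _ ((hφ m).sub (hφ n)))
    exact ((hφ m).sub (hφ n)).memL2_gradient.2.ne
  have hcau : CauchySeq fun n => (hφ n).memL2.toLp (φ n) := by
    rw [cauchySeq_iff_tendsto_dist_atTop_0]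
    have := (cauchySeq_iff_tendsto_dist_atTop_0.1 hlim.cauchySeq).const_mul (C : ℝ)
    rw [mul_zero] at this
    exact squeeze_zero (fun _ => dist_nonneg) (fun p => hdist p.1 p.2) this
  obtain ⟨V, hV⟩ := cauchySeq_tendsto_of_complete hcau
  refine ⟨V, memH10_of_tendsto (Lp.memLp V) (Lp.memLp G) hφ ?_ ?_⟩
  · refine ((Lp.tendsto_Lp_iff_tendsto_eLpNorm' _ _).1 hV).congr fun n => ?_
    refine eLpNorm_congr_ae ?_
    filter_upwards [(hφ n).memL2.coeFn_toLp] with x hx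
    simp [hx]
  · refine ((Lp.tendsto_Lp_iff_tendsto_eLpNorm' _ _).1 hlim).congr fun n => ?_
    refine eLpNorm_congr_ae ?_
    filter_upwards [hHφ n] with x hx
    simp [hx]

/-- The distance of an `L²` field to the gradients of `H¹₀(Ω)` is attained, by the orthogonal
projection. -/
theorem exists_minimizer_memH10 (hΩ : Bornology.IsBounded Ω) {r : Plane → Plane}
    (hr : MemL2 Ω r) :
    ∃ (v : Plane → ℝ) (gv : Plane → Plane), MemH10 Ω v gv ∧
      ∀ w gw, MemH10 Ω w gw → l2norm Ω (r - gv) ≤ l2norm Ω (r - gw) := by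
  set K := (testGradients Ω).topologicalClosure
  have hK : IsComplete (K : Set (Lp Plane 2 (volume.restrict Ω))) :=
    (Submodule.isClosed_topologicalClosure _).isComplete
  obtain ⟨G, hGK, hG⟩ := K.exists_norm_eq_iInf_of_complete_subspace hK (hr.toLp r)
  obtain ⟨v, hv⟩ := exists_memH10_of_mem_closure hΩ hGK
  refine ⟨v, G, hv, fun w gw hw => ?_⟩
  have hle : ‖hr.toLp r - G‖ ≤ ‖hr.toLp r - hw.memH1.grad_memL2.toLp gw‖ := by
    rw [hG]
    exact ciInf_le ⟨0, by rintro _ ⟨w, rfl⟩; exact norm_nonneg _⟩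
      (⟨_, hw.toLp_mem⟩ : K)
  have h1 : l2norm Ω (r - ⇑G) = ENNReal.ofReal ‖hr.toLp r - G‖ := by
    rw [ofReal_norm, Lp.enorm_def]
    exact eLpNorm_congr_ae ((hr.coeFn_toLp.symm.sub (ae_eq_refl _)).trans (Lp.coeFn_sub _ _).symm)
  have h2 : l2norm Ω (r - gw) =
      ENNReal.ofReal ‖hr.toLp r - hw.memH1.grad_memL2.toLp gw‖ := by
    rw [ofReal_norm, Lp.enorm_def]
    exact eLpNorm_congr_ae ((hr.coeFn_toLp.symm.sub hw.memH1.grad_memL2.coeFn_toLp.symm).trans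
      (Lp.coeFn_sub _ _).symm)
  rw [h1, h2]
  exact ENNReal.ofReal_le_ofReal hle

/-! ### The triangles partition the domain up to a null set -/

/-- A domain with Lipschitz boundary lies on one side of its boundary: each boundary point is a
limit of points strictly above the local graph, which are exterior points. -/
lemma interior_closure_subset (hopen : IsOpen Ω) (hL : HasLipschitzBoundary Ω) :
    interior (closure Ω) ⊆ Ω := by
  intro x hx
  by_contra hxΩ
  have hfr : x ∈ frontier Ω := ⟨interior_subset hx, by rwa [hopen.interior_eq]⟩
  obtain ⟨e, r, K, ψ, hr, hψ, hgraph⟩ := hL x hfr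
  have hx1 : ψ (e x 0) ≤ e x 1 :=
    not_lt.1 fun h => hxΩ ((hgraph x (Metric.mem_ball_self hr)).2 h)
  set d : Plane := e.symm (EuclideanSpace.single 1 1)
  have hray : Tendsto (fun t : ℝ => x + t • d) (𝓝[>] 0) (𝓝 x) := by
    have : Continuous fun t : ℝ => x + t • d := by fun_prop
    have := this.tendsto 0
    simp only [zero_smul, add_zero] at this
    exact this.mono_left nhdsWithin_le_nhds
  have h1 := hray.eventually (isOpen_interior.mem_nhds hx)
  have h2 := hray.eventually (Metric.ball_mem_nhds x hr)
  obtain ⟨t, ⟨ht1, ht2⟩, ht⟩ := ((h1.and h2).and self_mem_nhdsWithin).exists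
  have he : e (x + t • d) = e x + t • EuclideanSpace.single 1 1 := by simp [d]
  have hV : IsOpen (Metric.ball x r ∩ {y | ψ (e y 0) < e y 1}) := by
    refine Metric.isOpen_ball.inter (isOpen_lt ?_ ?_)
    · exact hψ.continuous.comp (by fun_prop)
    · fun_prop
  have hmem : x + t • d ∈ Metric.ball x r ∩ {y | ψ (e y 0) < e y 1} := by
    refine ⟨ht2, ?_⟩
    have : (0 : ℝ) < t := ht
    simp only [mem_ofPred_eq, he]
    simp
    linarith
  obtain ⟨y, ⟨hy1, hy2⟩, hy⟩ := mem_closure_iff.1 (interior_subset ht1) _ hV hmem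
  exact lt_asymm hy2 ((hgraph y hy1).1 hy)

lemma convex_hull (T : Finset Plane) : Convex ℝ (hull T) := convex_convexHull ℝ _

lemma isCompact_hull (T : Finset Plane) : IsCompact (hull T) :=
  T.finite_toSet.isCompact_convexHull ℝ

lemma interior_hull_ae_eq (T : Finset Plane) : interior (hull T) =ᵐ[volume] hull T :=
  interior_ae_eq_of_null_frontier ((convex_hull T).addHaar_frontier volume)

/-- Two points do not span the plane. -/
lemma interior_convexHull_eq_empty (S : Finset Plane) (hS : S.card ≤ 2) :
    interior (convexHull ℝ (S : Set Plane)) = ∅ := by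
  by_contra h
  have htop := interior_convexHull_nonempty_iff_affineSpan_eq_top.1 (nonempty_iff_ne_empty.2 h)
  have hne : (S : Set Plane).Nonempty := by
    by_contra hS0
    rw [not_nonempty_iff_eq_empty.1 hS0] at htop
    simp at htop
  have hcard : 0 < S.card := Finset.card_pos.2 (by exact_mod_cast hne)
  have h1 := finrank_vectorSpan_image_finset_le ℝ (id : Plane → Plane) S
    (n := S.card - 1) (by omega)
  have h2 : vectorSpan ℝ (S : Set Plane) = ⊤ := by
    rw [← direction_affineSpan, htop, AffineSubspace.direction_top]
  rw [Finset.image_id, h2, finrank_top, finrank_euclideanSpace_fin] at h1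
  omega

namespace Triangulation

variable (𝒯 : Triangulation Ω)

lemma hull_subset_closure {T : Finset Plane} (hT : T ∈ 𝒯.triangles) : hull T ⊆ closure Ω := by
  rw [← 𝒯.cover]
  exact subset_biUnion_of_mem (u := fun T => hull T) hT

lemma interior_hull_subset (hopen : IsOpen Ω) (hL : HasLipschitzBoundary Ω) {T : Finset Plane}
    (hT : T ∈ 𝒯.triangles) : interior (hull T) ⊆ Ω :=
  (interior_mono (𝒯.hull_subset_closure hT)).trans (interior_closure_subset hopen hL)

lemma pairwiseDisjoint_interior :
    (𝒯.triangles : Set (Finset Plane)).PairwiseDisjoint fun T => interior (hull T) := by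
  classical
  intro T hT T' hT' hne
  rw [Function.onFun, disjoint_iff_inter_eq_empty, ← interior_inter, 𝒯.conforming T hT T' hT',
    ← Finset.coe_inter]
  refine interior_convexHull_eq_empty _ ?_
  by_contra! h
  have h3 := 𝒯.card_eq T hT
  have h3' := 𝒯.card_eq T' hT'
  have e1 := Finset.eq_of_subset_of_card_le (Finset.inter_subset_left (s₁ := T) (s₂ := T'))
    (by omega)
  have e2 := Finset.eq_of_subset_of_card_le (Finset.inter_subset_right (s₁ := T) (s₂ := T'))
    (by omega)
  exact hne (e1.symm.trans e2)

lemma biUnion_interior_ae_eq (hopen : IsOpen Ω) (hL : HasLipschitzBoundary Ω) :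
    (⋃ T ∈ 𝒯.triangles, interior (hull T) : Set Plane) =ᵐ[volume] Ω := by
  refine EventuallyLE.antisymm ?_ ?_
  · have h : (⋃ T ∈ 𝒯.triangles, interior (hull T) : Set Plane) ⊆ Ω :=
      iUnion₂_subset fun T hT => 𝒯.interior_hull_subset hopen hL hT
    exact h.eventuallyLE
  · have h : (⋃ T ∈ 𝒯.triangles, interior (hull T) : Set Plane) =ᵐ[volume]
        (⋃ T ∈ 𝒯.triangles, hull T : Set Plane) :=
      Filter.EventuallyEq.countable_bUnion 𝒯.triangles.countable_toSet
        fun T _ => interior_hull_ae_eq T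
    rw [𝒯.cover] at h
    have hsub : Ω ⊆ closure Ω := subset_closure
    exact hsub.eventuallyLE.trans h.symm.le

lemma piecewiseConst_of_mem {V : Type*} [AddCommMonoid V] (c : Finset Plane → V)
    {T : Finset Plane} (hT : T ∈ 𝒯.triangles) {x : Plane} (hx : x ∈ interior (hull T)) :
    𝒯.piecewiseConst c x = c T := by
  rw [piecewiseConst, Finset.sum_eq_single_of_mem T hT, indicator_of_mem hx]
  intro T' hT' hne
  exact indicator_of_notMem
    (fun hx' => disjoint_left.1 (𝒯.pairwiseDisjoint_interior hT' hT hne) hx' hx) _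

end Triangulation

lemma l2norm_sq {V : Type*} [NormedAddCommGroup V] (D : Set Plane) (f : Plane → V) :
    l2norm D f ^ 2 = ∫⁻ x in D, ‖f x‖ₑ ^ 2 := by
  have h := eLpNorm_nnreal_pow_eq_lintegral (p := 2) (f := f) (μ := volume.restrict D) (by simp)
  have h2 : ((2 : ℝ≥0) : ℝ) = ((2 : ℕ) : ℝ) := by norm_num
  simp only [h2, ENNReal.rpow_natCast] at h
  exact h

/-- The square of the `L²` norm is additive over the triangles. -/
lemma Triangulation.l2norm_sq_eq_sum {V : Type*} [NormedAddCommGroup V] (𝒯 : Triangulation Ω)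
    (hopen : IsOpen Ω) (hL : HasLipschitzBoundary Ω) (f : Plane → V) :
    l2norm Ω f ^ 2 = ∑ T ∈ 𝒯.triangles, l2norm (interior (hull T)) f ^ 2 := by
  simp_rw [l2norm_sq]
  rw [← Measure.restrict_congr_set (𝒯.biUnion_interior_ae_eq hopen hL),
    lintegral_biUnion_finset 𝒯.pairwiseDisjoint_interior
      fun T _ => isOpen_interior.measurableSet]

/-! ### The inverse estimate on one triangle -/

/-- A fixed smooth bump function, supported in the disc of radius `1 / 3` about the origin. It is
even, which makes the mean of an affine function against it explicit. -/
noncomputable def refBump : ContDiffBump (0 : Plane) := ⟨1 / 4, 1 / 3, by norm_num, by norm_num⟩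

/-- The reference bump, moved to the centre `c` and scaled to the disc of radius `ρ / 3`. -/
noncomputable def bump (c : Plane) (ρ : ℝ) (x : Plane) : ℝ := refBump (ρ⁻¹ • (x - c))

lemma integral_refBump_pos : 0 < ∫ x, refBump x := refBump.integral_pos

section bump

variable {D : Set Plane} {c : Plane} {ρ : ℝ}

lemma abs_bump_le_one (x : Plane) : |bump c ρ x| ≤ 1 :=
  (abs_of_nonneg refBump.nonneg).trans_le refBump.le_one

lemma contDiff_bump : ContDiff ℝ ∞ (bump c ρ) :=
  
  refBump.contDiff.comp (f := fun x : Plane => ρ⁻¹ • (x - c)) (by fun_prop)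

lemma tsupport_bump_subset (hρ : 0 < ρ) : tsupport (bump c ρ) ⊆ Metric.closedBall c (ρ / 3) := by
  refine closure_minimal (fun x hx => ?_) Metric.isClosed_closedBall
  have h : ρ⁻¹ • (x - c) ∈ Function.support refBump := hx
  rw [refBump.support_eq, mem_ball_zero_iff, norm_smul, norm_inv, Real.norm_of_nonneg hρ.le,
    inv_mul_lt_iff₀ hρ] at h
  rw [mem_closedBall_iff_norm]
  have h2 : refBump.rOut = 1 / 3 := rfl
  rw [h2] at h
  linarith

lemma isTest_bump (hρ : 0 < ρ) (hD : Metric.closedBall c (ρ / 3) ⊆ D) : IsTest D (bump c ρ) :=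
  ⟨contDiff_bump, (isCompact_closedBall c (ρ / 3)).of_isClosed_subset (isClosed_tsupport _)
    (tsupport_bump_subset hρ), (tsupport_bump_subset hρ).trans hD⟩

lemma bump_reflect (y : Plane) : bump c ρ (c - y) = bump c ρ (c + y) := by
  rw [bump, bump, sub_sub_cancel_left, add_sub_cancel_left, smul_neg, refBump.neg]

lemma integral_bump (hρ : 0 < ρ) : ∫ x, bump c ρ x = ρ ^ 2 * ∫ x, refBump x := by
  have h1 : ∫ x, bump c ρ x = ∫ x, refBump (ρ⁻¹ • x) :=
    integral_sub_right_eq_self (fun x => refBump (ρ⁻¹ • x)) c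
  rw [h1, Measure.integral_comp_inv_smul, finrank_euclideanSpace_fin, smul_eq_mul,
    abs_of_nonneg (by positivity)]

/-- The mean of an affine function against an even bump is its value at the centre. -/
lemma integral_affine_mul_bump (hρ : 0 < ρ) (p : ℝ) (l : Plane →L[ℝ] ℝ) :
    ∫ x, (p + l x) * bump c ρ x = (p + l c) * (ρ ^ 2 * ∫ x, refBump x) := by
  have ht := isTest_bump (c := c) hρ (subset_univ _)
  have hint : Integrable fun x => (p + l x) * bump c ρ x := by
    refine Continuous.integrable_of_hasCompactSupport ?_ ht.compact.mul_left
    exact (continuous_const.add l.continuous).mul ht.smooth.continuous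
  have h1 : ∫ x, (p + l x) * bump c ρ x = ∫ y, (p + l (c + y)) * bump c ρ (c + y) :=
    (integral_add_left_eq_self (fun x => (p + l x) * bump c ρ x) c).symm
  -- Reflection in `c` fixes the bump; the average of the two forms of the integral loses the
  -- linear part.
  have h2 : ∫ x, (p + l x) * bump c ρ x = ∫ y, (p + l (c - y)) * bump c ρ (c + y) := by
    rw [← integral_sub_left_eq_self (fun x => (p + l x) * bump c ρ x) volume c]
    simp_rw [bump_reflect]
  have h3 : ∫ y, bump c ρ (c + y) = ρ ^ 2 * ∫ x, refBump x := by
    rw [integral_add_left_eq_self (fun x => bump c ρ x) c, integral_bump hρ]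
  have i1 : Integrable fun y => (p + l (c + y)) * bump c ρ (c + y) := hint.comp_add_left c
  have i2 : Integrable fun y => (p + l (c - y)) * bump c ρ (c + y) := by
    simpa only [bump_reflect] using hint.comp_sub_left c
  have h4 : (∫ x, (p + l x) * bump c ρ x) + ∫ x, (p + l x) * bump c ρ x =
      2 * ((p + l c) * (ρ ^ 2 * ∫ x, refBump x)) := by
    rw [← h3]
    nth_rewrite 1 [h1]
    rw [h2, ← integral_add i1 i2, ← integral_const_mul, ← integral_const_mul]
    congr 1
    ext y
    rw [map_add, map_sub]
    ring
  linarith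

end bump

/-- A gradient bound for the bumps, by scaling. -/
lemma exists_gradient_bump_bound :
    ∃ G : ℝ, 0 ≤ G ∧ ∀ (c : Plane) (ρ : ℝ), 0 < ρ → ∀ x i, |gradient (bump c ρ) x i| ≤ G / ρ := by
  have hcont : Continuous (fderiv ℝ (refBump : Plane → ℝ)) :=
    (refBump.contDiff (n := 1)).continuous_fderiv (by simp)
  obtain ⟨G, hG⟩ := hcont.bounded_above_of_compact_support (refBump.hasCompactSupport.fderiv ℝ)
  refine ⟨G, (norm_nonneg _).trans (hG 0), fun c ρ hρ x i => ?_⟩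
  have hd : HasFDerivAt (bump c ρ) ((fderiv ℝ refBump (ρ⁻¹ • (x - c))).comp
      (ρ⁻¹ • ContinuousLinearMap.id ℝ Plane)) x := by
    have h1 : HasFDerivAt (fun x : Plane => ρ⁻¹ • (x - c)) (ρ⁻¹ • ContinuousLinearMap.id ℝ Plane) x :=
      ((hasFDerivAt_id x).sub_const c).const_smul ρ⁻¹
    exact (((refBump.contDiff (n := 1)).differentiable (by simp) _).hasFDerivAt).comp x h1
  calc |gradient (bump c ρ) x i| ≤ ‖gradient (bump c ρ) x‖ := PiLp.norm_apply_le (gradient (bump c ρ) x) i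
    _ = ‖(fderiv ℝ refBump (ρ⁻¹ • (x - c))).comp (ρ⁻¹ • ContinuousLinearMap.id ℝ Plane)‖ := by
      rw [norm_gradient, hd.fderiv]
    _ ≤ G * (ρ⁻¹ * 1) := by
      refine (ContinuousLinearMap.opNorm_comp_le _ _).trans ?_
      refine mul_le_mul (hG _) ?_ (norm_nonneg _) ((norm_nonneg _).trans (hG 0))
      rw [norm_smul, norm_inv, Real.norm_of_nonneg hρ.le]
      gcongr
      exact ContinuousLinearMap.norm_id_le
    _ = G / ρ := by rw [mul_one, div_eq_mul_inv]

lemma IsTest.mono {D Ω : Set Plane} {φ : Plane → ℝ} (h : IsTest D φ) (hD : D ⊆ Ω) : IsTest Ω φ :=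
  ⟨h.smooth, h.compact, h.support.trans hD⟩

lemma MemH1.mono {D Ω : Set Plane} {v : Plane → ℝ} {g : Plane → Plane} (h : MemH1 Ω v g)
    (hD : D ⊆ Ω) : MemH1 D v g := by
  refine ⟨h.memL2.mono_measure (Measure.restrict_mono_set _ hD),
    h.grad_memL2.mono_measure (Measure.restrict_mono_set _ hD), fun φ hφ i => ?_⟩
  have hsupp := (subset_tsupport φ).trans hφ.support
  have h1 := h.weak_grad φ (hφ.mono hD) i
  have hs : ∀ f : Plane → ℝ, Function.support f ⊆ D → ∫ x in Ω, f x = ∫ x in D, f x := by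
    intro f hf
    rw [setIntegral_eq_integral_of_forall_compl_eq_zero fun x hx => by_contra fun h => hx (hf h),
      setIntegral_eq_integral_of_forall_compl_eq_zero
        fun x hx => by_contra fun h => hx (hD (hf h))]
  rwa [hs _ ((Function.support_mul_subset_right _ _).trans fun x hx =>
      hφ.support_gradient_subset fun h0 => hx (by rw [h0]; rfl)),
    hs _ ((Function.support_mul_subset_right _ _).trans hsupp)] at h1

/-- Integration by parts for a constant. -/
lemma IsTest.integral_gradient {D : Set Plane} {φ : Plane → ℝ} (h : IsTest D φ) (i : Fin 2) :
    ∫ x in D, gradient φ x i = 0 := by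
  rw [setIntegral_eq_integral_of_forall_compl_eq_zero fun x hx => by
    rw [by_contra fun h0 => hx (h.support_gradient_subset h0)]; rfl]
  have h1 := integral_mul_fderiv_eq_neg_fderiv_mul_of_integrable (μ := (volume : Measure Plane))
    (f := fun _ => (1 : ℝ)) (g := φ) (v := EuclideanSpace.single i 1) (by simp) ?_ ?_
    (fun x _ => differentiableAt_const _) (fun x _ => h.differentiable x)
  · simpa [gradient_apply] using h1
  · simp only [one_mul]
    exact (h.continuous_fderiv.clm_apply continuous_const).integrable_of_hasCompactSupport
      (h.compact.fderiv_apply ℝ _)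
  · simpa using h.smooth.continuous.integrable_of_hasCompactSupport h.compact

/-- An `L¹` bound of the value at `c` of an affine field, by testing against a bump at `c`: the
constant `k` is free because the gradient of the bump has mean zero. -/
lemma abs_affine_apply_le {D : Set Plane} (hfin : volume D ≠ ⊤)
    {v : Plane → ℝ} {g : Plane → Plane} (hv : MemH1 D v g) (k p : ℝ) (l : Plane →L[ℝ] ℝ) {c : Plane}
    {ρ G : ℝ} (hρ : 0 < ρ) (hc : Metric.closedBall c (ρ / 3) ⊆ D) (i : Fin 2)
    (hl : IntegrableOn l D) (hG : ∀ x, |gradient (bump c ρ) x i| ≤ G / ρ) :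
    |p + l c| * (ρ ^ 2 * ∫ x, refBump x) ≤
      (∫ x in D, |p + l x + g x i|) + G / ρ * ∫ x in D, |v x - k| := by
  have ht := isTest_bump hρ hc
  have : IsFiniteMeasure (volume.restrict D) := ⟨by simpa using hfin.lt_top⟩
  have hη : AEStronglyMeasurable (bump c ρ) (volume.restrict D) :=
    ht.smooth.continuous.aestronglyMeasurable
  have hη' : AEStronglyMeasurable (fun x => gradient (bump c ρ) x i) (volume.restrict D) :=
    (ht.memL2_gradient.apply i).1
  have iF : Integrable (fun x => p + l x) (volume.restrict D) := (integrable_const p).add hl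
  have ig : Integrable (fun x => g x i) (volume.restrict D) :=
    (hv.grad_memL2.apply i).integrable (by norm_num)
  have iv : Integrable (fun x => v x - k) (volume.restrict D) :=
    (hv.memL2.integrable (by norm_num)).sub (integrable_const k)
  have mul_bump : ∀ f : Plane → ℝ, Integrable f (volume.restrict D) →
      Integrable (fun x => f x * bump c ρ x) (volume.restrict D) := fun f hf =>
    hf.mul_bdd hη (ae_of_all _ fun x => abs_bump_le_one x)
  have mul_grad : ∀ f : Plane → ℝ, Integrable f (volume.restrict D) →
      Integrable (fun x => f x * gradient (bump c ρ) x i) (volume.restrict D) := fun f hf =>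
    hf.mul_bdd hη' (ae_of_all _ hG)
  have key : (p + l c) * (ρ ^ 2 * ∫ x, refBump x) =
      (∫ x in D, (p + l x + g x i) * bump c ρ x) + ∫ x in D, (v x - k) * gradient (bump c ρ) x i := by
    have e1 : (p + l c) * (ρ ^ 2 * ∫ x, refBump x) = ∫ x in D, (p + l x) * bump c ρ x := by
      rw [← integral_affine_mul_bump hρ, setIntegral_eq_integral_of_forall_compl_eq_zero]
      intro x hx
      rw [image_eq_zero_of_notMem_tsupport fun h => hx (ht.support h), mul_zero]
    have e2 := hv.weak_grad _ ht i
    have e3 := ht.integral_gradient i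
    simp_rw [add_mul _ (g _ i), sub_mul]
    rw [integral_add (mul_bump _ iF) (mul_bump _ ig),
      integral_sub (mul_grad _ (hv.memL2.integrable (by norm_num))) (mul_grad _ (integrable_const k)),
      integral_const_mul, e1, e2, e3]
    ring
  have hm : 0 ≤ ρ ^ 2 * ∫ x, refBump x := mul_nonneg (sq_nonneg ρ) integral_refBump_pos.le
  rw [← abs_of_nonneg hm, ← abs_mul, key]
  refine (abs_add_le _ _).trans (add_le_add ?_ ?_)
  · refine (abs_integral_le_integral_abs).trans
      (integral_mono (mul_bump _ (iF.add ig)).abs (iF.add ig).abs fun x => ?_)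
    rw [abs_mul]
    exact mul_le_of_le_one_right (abs_nonneg _) (abs_bump_le_one x)
  · rw [← integral_const_mul]
    refine (abs_integral_le_integral_abs).trans
      (integral_mono (mul_grad _ iv).abs (iv.abs.const_mul _) fun x => ?_)
    simp only [abs_mul]
    rw [mul_comm]
    exact mul_le_mul_of_nonneg_right (hG x) (abs_nonneg _)

lemma MemL2.setIntegral_norm_le {V : Type*} [NormedAddCommGroup V] {D : Set Plane}
    (hfin : volume D ≠ ⊤) {f : Plane → V} (hf : MemL2 D f) :
    ∫ x in D, ‖f x‖ ≤ √(volume.real D) * (l2norm D f).toReal := by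
  have h := eLpNorm_le_eLpNorm_mul_rpow_measure_univ (p := 1) (q := 2)
    (μ := volume.restrict D) (f := f) (by norm_num) hf.1
  rw [Measure.restrict_apply_univ, ENNReal.toReal_one, ENNReal.toReal_ofNat,
    eLpNorm_one_eq_lintegral_enorm] at h
  rw [integral_norm_eq_lintegral_enorm hf.1, Real.sqrt_eq_rpow, measureReal_def,
    ENNReal.toReal_rpow, mul_comm, ← ENNReal.toReal_mul]
  refine ENNReal.toReal_mono ?_ (h.trans_eq ?_)
  · exact ENNReal.mul_ne_top hf.2.ne (by finiteness)
  · norm_num [l2norm]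

lemma norm_le_abs_add_abs (y : Plane) : ‖y‖ ≤ |y 0| + |y 1| := by
  rw [EuclideanSpace.norm_eq, Real.sqrt_le_left (by positivity)]
  simp only [Fin.sum_univ_two, Real.norm_eq_abs]
  nlinarith [abs_nonneg (y 0), abs_nonneg (y 1)]

/-- An inverse estimate for an affine field `F` on a set of size `h` that contains a disc of
comparable size: `h ‖F‖ ≤ C (h ‖F + ∇v‖ + ‖v - k‖)` for each constant `k`. The values of `F` on a
small disc are controlled by testing against bumps, and those on the whole set by extrapolation. -/
theorem exists_inverse_estimate {κ : ℝ} (hκ : 0 < κ) :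
    ∃ C : ℝ≥0, ∀ (D : Set Plane) (z : Plane) (h : ℝ), MeasurableSet D → 0 < h → Metric.ball z (h / κ) ⊆ D →
      D ⊆ Metric.closedBall z h → ∀ (v : Plane → ℝ) (g : Plane → Plane), MemH1 D v g →
      ∀ (k : ℝ) (p : Plane) (M : Plane →L[ℝ] Plane),
        ENNReal.ofReal h * l2norm D (fun x => p + M x) ≤
          C * (ENNReal.ofReal h * l2norm D (fun x => p + M x + g x) +
            l2norm D (fun x => v x - k)) := by
  obtain ⟨G, hG0, hG⟩ := exists_gradient_bump_bound
  set m := ∫ x, refBump x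
  have hm0 : 0 < m := integral_refBump_pos
  set S := √(volume.real (Metric.ball (0 : Plane) 1)) with hS
  have hS0 : 0 ≤ S := Real.sqrt_nonneg _
  refine ⟨((1 + 4 * κ) * (2 * κ ^ 2 * S ^ 2 / m) * (1 + G * κ)).toNNReal, ?_⟩
  intro D z h hDm hh hball hDsub v g hv k p M
  set ρ := h / κ with hρdef
  have hρ : 0 < ρ := by positivity
  have hfin : volume D ≠ ⊤ := (Metric.isBounded_closedBall.subset hDsub).measure_lt_top.ne
  have : IsFiniteMeasure (volume.restrict D) := ⟨by simpa using hfin.lt_top⟩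
  have hvol : √(volume.real D) ≤ h * S := by
    rw [hS, Real.sqrt_le_left (by positivity), mul_pow, Real.sq_sqrt measureReal_nonneg]
    calc volume.real D ≤ volume.real (Metric.closedBall z h) :=
          measureReal_mono hDsub measure_closedBall_lt_top.ne
      _ = h ^ 2 * volume.real (Metric.ball (0 : Plane) 1) := by
          rw [Measure.addHaar_real_closedBall _ _ hh.le, finrank_euclideanSpace_fin]
  have hM : IntegrableOn M D :=
    (M.continuous.continuousOn.integrableOn_compact (isCompact_closedBall z h)).mono_set hDsub
  have hF2 : MemL2 D fun x => p + M x := by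
    refine (memLp_const p).add (MemLp.of_bound M.continuous.aestronglyMeasurable
      (‖M‖ * (‖z‖ + h)) ?_)
    refine ae_restrict_of_forall_mem hDm fun x hx => (M.le_opNorm x).trans ?_
    gcongr
    calc ‖x‖ ≤ ‖z‖ + ‖x - z‖ := norm_le_insert' x z
      _ ≤ ‖z‖ + h := by
        gcongr
        simpa [dist_eq_norm] using hDsub hx
  have hE2 : MemL2 D fun x => p + M x + g x := hF2.add hv.grad_memL2
  have hU2 : MemL2 D fun x => v x - k := hv.memL2.sub (memLp_const k)
  set E := (l2norm D (fun x => p + M x + g x)).toReal with hE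
  set U := (l2norm D (fun x => v x - k)).toReal with hU
  have hE0 : 0 ≤ E := ENNReal.toReal_nonneg
  have hU0 : 0 ≤ U := ENNReal.toReal_nonneg
  set B := 2 * (κ ^ 2 * S / (m * h) * (E + G * κ / h * U)) with hB
  -- A bump of radius `ρ / 3` about a point within `ρ / 2` of `z` stays in the disc of radius `ρ`.
  have hsmall : ∀ c ∈ Metric.closedBall z (ρ / 2), ‖p + M c‖ ≤ B := by
    intro c hc
    have hcD : Metric.closedBall c (ρ / 3) ⊆ D := by
      refine (Metric.closedBall_subset_ball' ?_).trans hball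
      rw [Metric.mem_closedBall] at hc
      linarith
    have hcoord : ∀ i : Fin 2, |(p + M c) i| ≤ κ ^ 2 * S / (m * h) * (E + G * κ / h * U) := by
      intro i
      have h1 := abs_affine_apply_le hfin hv k (p i) ((EuclideanSpace.proj i).comp M) hρ hcD i
        ((EuclideanSpace.proj (𝕜 := ℝ) i).integrable_comp hM) (fun x => hG c ρ hρ x i)
      have h2 : ∫ x in D, |p i + ((EuclideanSpace.proj i).comp M) x + g x i| ≤ h * S * E := by
        refine (integral_mono_of_nonneg (ae_of_all _ fun x => abs_nonneg _)
          (hE2.integrable (by norm_num)).norm (ae_of_all _ fun x => ?_)).trans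
          ((hE2.setIntegral_norm_le hfin).trans (mul_le_mul_of_nonneg_right hvol hE0))
        exact PiLp.norm_apply_le (p + M x + g x) i
      have h3 : ∫ x in D, |v x - k| ≤ h * S * U :=
        (hU2.setIntegral_norm_le hfin).trans (mul_le_mul_of_nonneg_right hvol hU0)
      have h4 : |(p + M c) i| * (ρ ^ 2 * m) ≤ h * S * E + G / ρ * (h * S * U) :=
        h1.trans (add_le_add h2 (mul_le_mul_of_nonneg_left h3 (by positivity)))
      rw [← le_div_iff₀ (by positivity)] at h4
      refine h4.trans_eq ?_
      rw [hρdef]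
      field_simp
    exact (norm_le_abs_add_abs _).trans (by linarith [hcoord 0, hcoord 1])
  have hB0 : 0 ≤ B := by positivity
  -- Each `x` in `D` lies on a ray from `z` through a point `c` of the small disc, at distance at most
  -- `2 κ |c - z|`.
  have hlarge : ∀ x ∈ D, ‖p + M x‖ ≤ (1 + 4 * κ) * B := by
    intro x hx
    have hxz : ‖x - z‖ ≤ h := by simpa [dist_eq_norm] using hDsub hx
    set c := z + (2 * κ)⁻¹ • (x - z) with hc
    have hcz : c ∈ Metric.closedBall z (ρ / 2) := by
      rw [mem_closedBall_iff_norm, hc, add_sub_cancel_left, norm_smul, norm_inv,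
        Real.norm_of_nonneg (by positivity), inv_mul_le_iff₀ (by positivity), hρdef]
      refine hxz.trans_eq ?_
      field_simp
    have hxc : p + M x = (p + M z) + (2 * κ) • ((p + M c) - (p + M z)) := by
      have : M c = M z + (2 * κ)⁻¹ • (M x - M z) := by simp [hc]
      rw [this, add_sub_add_left_eq_sub, add_sub_cancel_left, smul_smul,
        mul_inv_cancel₀ (by positivity), one_smul]
      abel
    have hz := hsmall z (Metric.mem_closedBall_self (by positivity))
    rw [hxc]
    calc _ ≤ ‖p + M z‖ + (2 * κ) * (‖p + M c‖ + ‖p + M z‖) := by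
          refine (norm_add_le _ _).trans ?_
          rw [norm_smul, Real.norm_of_nonneg (by positivity)]
          gcongr
          exact norm_sub_le _ _
      _ ≤ B + (2 * κ) * (B + B) := by
          gcongr
          exact hsmall c hcz
      _ = (1 + 4 * κ) * B := by ring
  have hF : l2norm D (fun x => p + M x) ≤ ENNReal.ofReal (h * S * ((1 + 4 * κ) * B)) := by
    refine (eLpNorm_le_of_ae_bound (ae_restrict_of_forall_mem hDm hlarge)).trans ?_
    rw [Measure.restrict_apply_univ, ENNReal.ofReal_mul (p := h * S) (by positivity),
      ENNReal.toReal_ofNat,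
      ← ENNReal.ofReal_toReal hfin, ENNReal.ofReal_rpow_of_nonneg ENNReal.toReal_nonneg (by norm_num)]
    refine mul_le_mul' (ENNReal.ofReal_le_ofReal ?_) le_rfl
    rwa [Real.sqrt_eq_rpow, one_div] at hvol
  have hEfin : l2norm D (fun x => p + M x + g x) ≠ ⊤ := hE2.2.ne
  have hUfin : l2norm D (fun x => v x - k) ≠ ⊤ := hU2.2.ne
  rw [← ENNReal.ofReal_toReal hEfin, ← ENNReal.ofReal_toReal hUfin, ← hE, ← hU,
    ← ENNReal.ofReal_mul hh.le, ← ENNReal.ofReal_add (by positivity) hU0,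
    ← ENNReal.ofReal, ← ENNReal.ofReal_mul (by positivity)]
  refine (mul_le_mul_right hF _).trans ?_
  rw [← ENNReal.ofReal_mul hh.le]
  refine ENNReal.ofReal_le_ofReal ?_
  calc h * (h * S * ((1 + 4 * κ) * B))
      = (1 + 4 * κ) * (2 * κ ^ 2 * S ^ 2 / m) * (h * E + G * κ * U) := by
        rw [hB]
        field_simp
    _ ≤ (1 + 4 * κ) * (2 * κ ^ 2 * S ^ 2 / m) * ((1 + G * κ) * (h * E + U)) := by
        gcongr
        have h1 : 0 ≤ G * κ * (h * E) := by positivity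
        linarith
    _ = _ := by ring

/-! ### The mesh-size weighted estimate on the domain -/

lemma ennreal_add_sq_le (a b : ℝ≥0∞) : (a + b) ^ 2 ≤ 4 * (a ^ 2 + b ^ 2) := by
  wlog h : a ≤ b generalizing a b
  · rw [add_comm a, add_comm (a ^ 2)]
    exact this b a (le_of_not_ge h)
  calc (a + b) ^ 2 ≤ (b + b) ^ 2 := by gcongr
    _ = 4 * b ^ 2 := by ring
    _ ≤ 4 * (a ^ 2 + b ^ 2) := by gcongr; exact le_add_self

lemma l2norm_const_smul {V : Type*} [NormedAddCommGroup V] [NormedSpace ℝ V] (D : Set Plane)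
    {c : ℝ} (hc : 0 ≤ c) (f : Plane → V) :
    l2norm D (fun x => c • f x) = ENNReal.ofReal c * l2norm D f := by
  have := eLpNorm_const_smul c f 2 (volume.restrict D)
  rwa [Real.enorm_of_nonneg hc] at this

/-- Summation of the inverse estimates for a field that is affine on each triangle. -/
theorem exists_meshSize_estimate (hΩ : IsPolygonalLipschitzDomain Ω) {κ : ℝ} (hκ : 0 < κ) :
    ∃ C : ℝ≥0, ∀ 𝒯 : Triangulation Ω, 𝒯.ShapeRegular κ →
      ∀ (v : Plane → ℝ) (g : Plane → Plane), MemH1 Ω v g →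
      ∀ w : Plane → ℝ, 𝒯.MemP0 w → ∀ r : Plane → Plane,
        (∀ T ∈ 𝒯.triangles, ∃ (p : Plane) (M : Plane →L[ℝ] Plane),
          ∀ᵐ x ∂volume.restrict (interior (hull T)), r x = p + M x) →
        l2norm Ω (fun x => 𝒯.meshSize x • r x) ≤ C * (l2norm Ω (r + g) + l2norm Ω (v - w)) := by
  obtain ⟨C, hC⟩ := exists_inverse_estimate hκ
  set d : ℝ≥0 := (Metric.diam Ω).toNNReal with hd
  refine ⟨2 * C * (d + 1), fun 𝒯 h𝒯 v g hv w hw r hr => ?_⟩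
  obtain ⟨k, hk⟩ := hw
  have hdiam : ∀ T ∈ 𝒯.triangles, Metric.diam (hull T) ≤ d := fun T hT => by
    refine (Metric.diam_mono (𝒯.hull_subset_closure hT) hΩ.bounded.closure).trans_eq ?_
    rw [Metric.diam_closure, hd, Real.coe_toNNReal _ Metric.diam_nonneg]
  have hloc : ∀ T ∈ 𝒯.triangles,
      l2norm (interior (hull T)) (fun x => 𝒯.meshSize x • r x) ≤
        C * (d * l2norm (interior (hull T)) (r + g) + l2norm (interior (hull T)) (v - w)) := by
    intro T hT
    set D := interior (hull T)
    have hDm : MeasurableSet D := isOpen_interior.measurableSet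
    have h1 : l2norm D (fun x => 𝒯.meshSize x • r x) =
        ENNReal.ofReal (Metric.diam (hull T)) * l2norm D r := by
      rw [← l2norm_const_smul D Metric.diam_nonneg]
      refine eLpNorm_congr_ae (ae_restrict_of_forall_mem hDm fun x hx => ?_)
      change 𝒯.piecewiseConst _ x • r x = _
      rw [𝒯.piecewiseConst_of_mem _ hT hx]
    rw [h1]
    rcases (Metric.diam_nonneg (s := hull T)).eq_or_lt with h0 | h0
    · rw [← h0, ENNReal.ofReal_zero, zero_mul]
      exact zero_le
    obtain ⟨z, hz⟩ := h𝒯 T hT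
    obtain ⟨p, M, hpM⟩ := hr T hT
    have hzT : z ∈ hull T := hz (Metric.mem_closedBall_self (by positivity))
    have hest := hC D z (Metric.diam (hull T)) hDm h0
      (interior_maximal (Metric.ball_subset_closedBall.trans hz) Metric.isOpen_ball)
      (fun x hx => Metric.dist_le_diam_of_mem (isCompact_hull T).isBounded
        (interior_subset hx) hzT) v g
      (hv.mono (𝒯.interior_hull_subset hΩ.isOpen hΩ.lipschitz hT)) (k T) p M
    have e1 : l2norm D (fun x => p + M x) = l2norm D r :=
      eLpNorm_congr_ae (hpM.mono fun x hx => hx.symm)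
    have e2 : l2norm D (fun x => p + M x + g x) = l2norm D (r + g) :=
      eLpNorm_congr_ae (hpM.mono fun x hx => by simp only [Pi.add_apply, hx])
    have e3 : l2norm D (fun x => v x - k T) = l2norm D (v - w) :=
      eLpNorm_congr_ae ((ae_restrict_of_ae_restrict_of_subset interior_subset (hk T hT)).mono
        fun x hx => by simp only [Pi.sub_apply, hx])
    rw [e1, e2, e3] at hest
    refine hest.trans ?_
    gcongr
    rw [← ENNReal.ofReal_coe_nnreal]
    exact ENNReal.ofReal_le_ofReal (hdiam T hT)
  refine (ENNReal.pow_le_pow_left_iff two_ne_zero).1 ?_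
  calc l2norm Ω (fun x => 𝒯.meshSize x • r x) ^ 2
      = ∑ T ∈ 𝒯.triangles, l2norm (interior (hull T)) (fun x => 𝒯.meshSize x • r x) ^ 2 :=
        𝒯.l2norm_sq_eq_sum hΩ.isOpen hΩ.lipschitz _
    _ ≤ ∑ T ∈ 𝒯.triangles, (C : ℝ≥0∞) ^ 2 * (4 * (d ^ 2 * l2norm (interior (hull T)) (r + g) ^ 2 +
          l2norm (interior (hull T)) (v - w) ^ 2)) := by
        refine Finset.sum_le_sum fun T hT => (pow_le_pow_left' (hloc T hT) 2).trans ?_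
        rw [mul_pow, ← mul_pow (d : ℝ≥0∞)]
        gcongr
        exact ennreal_add_sq_le _ _
    _ = (C : ℝ≥0∞) ^ 2 * (4 * (d ^ 2 * l2norm Ω (r + g) ^ 2 + l2norm Ω (v - w) ^ 2)) := by
        rw [𝒯.l2norm_sq_eq_sum hΩ.isOpen hΩ.lipschitz (r + g),
          𝒯.l2norm_sq_eq_sum hΩ.isOpen hΩ.lipschitz (v - w), ← Finset.mul_sum, ← Finset.mul_sum,
          Finset.sum_add_distrib, Finset.mul_sum]
    _ ≤ (C : ℝ≥0∞) ^ 2 * (4 * (((d : ℝ≥0∞) + 1) * (l2norm Ω (r + g) + l2norm Ω (v - w))) ^ 2) := by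
        gcongr
        rw [← mul_pow]
        calc _ ≤ (d * l2norm Ω (r + g) + l2norm Ω (v - w)) ^ 2 := by
              rw [add_sq]
              gcongr
              exact le_self_add
          _ ≤ _ := by
              gcongr
              rw [add_mul, mul_add, one_mul]
              gcongr
              · exact le_self_add
              · exact le_add_self
    _ = _ := by
        push_cast
        ring

/-! ### The residual field -/

lemma mulE_add (N : Matrix (Fin 2) (Fin 2) ℝ) (ξ η : Plane) :
    mulE N (ξ + η) = mulE N ξ + mulE N η := map_add (Matrix.toEuclideanLin N) ξ η

lemma mulE_sub (N : Matrix (Fin 2) (Fin 2) ℝ) (ξ η : Plane) :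
    mulE N (ξ - η) = mulE N ξ - mulE N η := map_sub (Matrix.toEuclideanLin N) ξ η

lemma mulE_neg (N : Matrix (Fin 2) (Fin 2) ℝ) (ξ : Plane) :
    mulE N (-ξ) = -mulE N ξ := map_neg (Matrix.toEuclideanLin N) ξ

lemma mulE_smul (N : Matrix (Fin 2) (Fin 2) ℝ) (c : ℝ) (ξ : Plane) :
    mulE N (c • ξ) = c • mulE N ξ := map_smul (Matrix.toEuclideanLin N) c ξ

lemma sub_mulE (N N' : Matrix (Fin 2) (Fin 2) ℝ) (ξ : Plane) :
    mulE (N - N') ξ = mulE N ξ - mulE N' ξ := by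
  rw [mulE, Matrix.sub_mulVec]
  rfl

lemma mulE_mulE (N N' : Matrix (Fin 2) (Fin 2) ℝ) (ξ : Plane) :
    mulE N (mulE N' ξ) = mulE (N * N') ξ := by
  rw [mulE, mulE, mulE, Matrix.mulVec_mulVec]

lemma one_mulE (ξ : Plane) : mulE 1 ξ = ξ := by
  rw [mulE, Matrix.one_mulVec]

section coercive

variable {N : Matrix (Fin 2) (Fin 2) ℝ} {a : ℝ}

lemma isUnit_det_of_coercive (ha : 0 < a) (h : ∀ ξ : Plane, a * ‖ξ‖ ^ 2 ≤ inner ℝ (mulE N ξ) ξ) :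
    IsUnit N.det := by
  rw [isUnit_iff_ne_zero]
  intro h0
  obtain ⟨w, hw0, hw⟩ := Matrix.exists_mulVec_eq_zero_iff.2 h0
  have h1 := h (WithLp.toLp 2 w)
  have h2 : mulE N (WithLp.toLp 2 w) = 0 := by
    rw [mulE, hw]
    rfl
  rw [h2, inner_zero_left] at h1
  have h3 : (WithLp.toLp 2 w : Plane) ≠ 0 := fun h => hw0 (congrArg WithLp.ofLp h)
  have : 0 < a * ‖(WithLp.toLp 2 w : Plane)‖ ^ 2 := by
    have := norm_pos_iff.2 h3
    positivity
  linarith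

lemma norm_inv_mulE_le (ha : 0 < a) (h : ∀ ξ : Plane, a * ‖ξ‖ ^ 2 ≤ inner ℝ (mulE N ξ) ξ)
    (ξ : Plane) : ‖mulE N⁻¹ ξ‖ ≤ a⁻¹ * ‖ξ‖ := by
  have h1 := h (mulE N⁻¹ ξ)
  rw [mulE_mulE, Matrix.mul_nonsing_inv _ (isUnit_det_of_coercive ha h), one_mulE] at h1
  have h2 := h1.trans (real_inner_le_norm _ _)
  rcases (norm_nonneg (mulE N⁻¹ ξ)).eq_or_lt with h0 | h0
  · rw [← h0]
    positivity
  · rw [inv_mul_eq_div, le_div_iff₀ ha]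
    nlinarith

end coercive

section measurability

variable {N : Plane → Matrix (Fin 2) (Fin 2) ℝ}

lemma aestronglyMeasurable_mulE {q : Plane → Plane} {μ : Measure Plane}
    (hN : ∀ i j, AEStronglyMeasurable (fun x => N x i j) μ) (hq : AEStronglyMeasurable q μ) :
    AEStronglyMeasurable (fun x => mulE (N x) (q x)) μ := by
  have hqi : ∀ i, AEStronglyMeasurable (fun x => q x i) μ := fun i =>
    (PiLp.continuous_apply 2 (fun _ : Fin 2 => ℝ) i).comp_aestronglyMeasurable hq
  refine (PiLp.continuous_toLp 2 _).comp_aestronglyMeasurable (g := fun ξ => WithLp.toLp 2 ξ)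
    (f := fun x => N x *ᵥ (q x).ofLp) ?_
  refine (aemeasurable_pi_lambda _ fun i => ?_).aestronglyMeasurable
  simp only [Matrix.mulVec, dotProduct, Fin.sum_univ_two]
  exact (((hN i 0).mul (hqi 0)).add ((hN i 1).mul (hqi 1))).aemeasurable

lemma aestronglyMeasurable_inv {μ : Measure Plane}
    (hN : ∀ i j, AEStronglyMeasurable (fun x => N x i j) μ) (i j : Fin 2) :
    AEStronglyMeasurable (fun x => (N x)⁻¹ i j) μ := by
  have hdet : AEStronglyMeasurable (fun x => ((N x).det)⁻¹) μ := by
    simp only [Matrix.det_fin_two]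
    exact (((hN 0 0).mul (hN 1 1)).sub ((hN 0 1).mul (hN 1 0))).aemeasurable.inv.aestronglyMeasurable
  have hadj : AEStronglyMeasurable (fun x => (N x).adjugate i j) μ := by
    simp only [Matrix.adjugate_fin_two]
    fin_cases i <;> fin_cases j
    exacts [hN 1 1, (hN 0 1).neg, (hN 1 0).neg, hN 0 0]
  simp only [Matrix.inv_def, Ring.inverse_eq_inv', Matrix.smul_apply, smul_eq_mul]
  exact hdet.mul hadj

lemma Triangulation.aestronglyMeasurable_proj {V : Type*} [NormedAddCommGroup V] [NormedSpace ℝ V]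
    (𝒯 : Triangulation Ω) (f : Plane → V) (μ : Measure Plane) :
    AEStronglyMeasurable (𝒯.proj f) μ := by
  refine Finset.aestronglyMeasurable_fun_sum _ fun T _ => ?_
  exact aestronglyMeasurable_const.indicator isOpen_interior.measurableSet

end measurability

namespace Triangulation

variable (𝒯 : Triangulation Ω)

/-- The coefficients of the residual field are constant on each triangle, so that it is affine
there. -/
lemma exists_residualField_eq_affine (A : Plane → Matrix (Fin 2) (Fin 2) ℝ) (b : Plane → Plane)
    {pM : Plane → Plane} {uM : Plane → ℝ} (hp : 𝒯.MemRT0 pM) (hu : 𝒯.MemP0 uM) {T : Finset Plane}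
    (hT : T ∈ 𝒯.triangles) : ∃ (p : Plane) (M : Plane →L[ℝ] Plane),
      ∀ᵐ x ∂volume.restrict (interior (hull T)), 𝒯.residualField A b pM uM x = p + M x := by
  obtain ⟨-, c, d, hc, -⟩ := hp
  obtain ⟨k, hk⟩ := hu
  set N : Matrix (Fin 2) (Fin 2) ℝ := Matrix.of fun i j => ⨍ y in hull T, A y i j with hN
  refine ⟨mulE N⁻¹ (c T) + k T • mulE N⁻¹ (⨍ y in hull T, b y),
    d T • (Matrix.toEuclideanLin N⁻¹).toContinuousLinearMap, ?_⟩
  filter_upwards [ae_restrict_of_ae_restrict_of_subset interior_subset (hc T hT),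
    ae_restrict_of_ae_restrict_of_subset interior_subset (hk T hT),
    ae_restrict_mem isOpen_interior.measurableSet] with x hx1 hx2 hx3
  have h1 : 𝒯.projMat A x = N := by
    ext i j
    exact 𝒯.piecewiseConst_of_mem _ hT hx3
  have h2 : 𝒯.proj b x = ⨍ y in hull T, b y := 𝒯.piecewiseConst_of_mem _ hT hx3
  rw [residualField, bStarH, bStar, h1, h2, hx1, hx2, mulE_add, mulE_smul]
  change _ = _ + d T • mulE N⁻¹ x
  abel

/-- A function that is continuous on each triangle is square integrable on the domain. -/
lemma memL2_of_piecewise_continuous {V : Type*} [NormedAddCommGroup V]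
    (hΩ : IsPolygonalLipschitzDomain Ω) {r : Plane → V}
    (hr : ∀ T ∈ 𝒯.triangles, ∃ F : Plane → V, Continuous F ∧
      r =ᵐ[volume.restrict (interior (hull T))] F) : MemL2 Ω r := by
  have hloc : ∀ T ∈ 𝒯.triangles, MemL2 (interior (hull T)) r := by
    intro T hT
    obtain ⟨F, hcont, h⟩ := hr T hT
    obtain ⟨B, hB⟩ := (isCompact_hull T).exists_bound_of_continuousOn hcont.continuousOn
    have : IsFiniteMeasure (volume.restrict (interior (hull T))) :=
      ⟨by simpa using (measure_mono interior_subset).trans_lt (isCompact_hull T).measure_lt_top⟩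
    refine (MemLp.of_bound hcont.aestronglyMeasurable B ?_).ae_eq h.symm
    exact ae_restrict_of_forall_mem isOpen_interior.measurableSet
      fun x hx => hB x (interior_subset hx)
  refine ⟨?_, ?_⟩
  · have hUnion : (⋃ T ∈ 𝒯.triangles, interior (hull T)) =
        ⋃ T : 𝒯.triangles, interior (hull (T : Finset Plane)) := by
      ext x
      simp
    rw [← Measure.restrict_congr_set (𝒯.biUnion_interior_ae_eq hΩ.isOpen hΩ.lipschitz), hUnion,
      aestronglyMeasurable_iUnion_iff]
    exact fun T => (hloc T T.2).1
  · have h1 : l2norm Ω r ^ 2 < ⊤ := by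
      rw [𝒯.l2norm_sq_eq_sum hΩ.isOpen hΩ.lipschitz, ENNReal.sum_lt_top]
      exact fun T hT => ENNReal.pow_lt_top (hloc T hT).2
    exact (ENNReal.pow_lt_top_iff.1 h1).resolve_right two_ne_zero

end Triangulation

lemma MemH10.neg {v : Plane → ℝ} {g : Plane → Plane} (h : MemH10 Ω v g) : MemH10 Ω (-v) (-g) := by
  obtain ⟨φ, hφ, h₁, h₂⟩ := h.approx
  refine memH10_of_tendsto h.memH1.memL2.neg h.memH1.grad_memL2.neg
    (φ := fun n => (-1 : ℝ) • φ n) (fun n => (hφ n).smul (-1)) ?_ ?_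
  · refine h₁.congr fun n => eLpNorm_congr_norm_ae (ae_of_all _ fun x => ?_)
    rw [← norm_neg]
    simp [sub_eq_add_neg, add_comm]
  · refine h₂.congr fun n => eLpNorm_congr_norm_ae (ae_of_all _ fun x => ?_)
    rw [← norm_neg, (hφ n).gradient_smul]
    simp [sub_eq_add_neg, add_comm]

lemma l2norm_add_le {V : Type*} [NormedAddCommGroup V] {D : Set Plane} {f g : Plane → V}
    (hf : AEStronglyMeasurable f (volume.restrict D))
    (hg : AEStronglyMeasurable g (volume.restrict D)) :
    l2norm D (f + g) ≤ l2norm D f + l2norm D g := eLpNorm_add_le hf hg (by norm_num)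

/-- The distance of the residual field to `-∇u`, by inserting the definition of the flux. -/
theorem l2norm_residualField_add_le (hΩ : IsOpen Ω) {A : Plane → Matrix (Fin 2) (Fin 2) ℝ}
    {b : Plane → Plane} {γ : Plane → ℝ} {a L β : ℝ} (hA : CoeffAssumption Ω A b γ a L)
    (hb : ∀ x ∈ Ω, ‖b x‖ ≤ β) {u : Plane → ℝ} {gu : Plane → Plane} (hu : MemH1 Ω u gu)
    (𝒯 : Triangulation Ω) {pM : Plane → Plane} {uM : Plane → ℝ} (hp : MemL2 Ω pM)
    (huM : MemL2 Ω uM) :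
    l2norm Ω (𝒯.residualField A b pM uM + gu) ≤
      (1 + Real.toNNReal a⁻¹ + Real.toNNReal (a⁻¹ * |β|) : ℝ≥0) *
        (l2norm Ω (u - uM) + l2norm Ω (flux A b u gu - pM) +
            l2norm Ω (fun x => mulE ((A x)⁻¹ - (𝒯.projMat A x)⁻¹) (pM x)) +
            l2norm Ω (fun x => uM x • (bStar A b x - 𝒯.bStarH A b x))) := by
  have ha := hA.pos
  have hbm : AEStronglyMeasurable b (volume.restrict Ω) := by
    obtain ⟨K, hK⟩ := hA.lipb
    exact hK.continuousOn.aestronglyMeasurable hΩ.measurableSet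
  have hAm : ∀ i j, AEStronglyMeasurable (fun x => A x i j) (volume.restrict Ω) := fun i j => by
    obtain ⟨K, hK⟩ := hA.lipA i j
    exact hK.continuousOn.aestronglyMeasurable hΩ.measurableSet
  have hAinv := aestronglyMeasurable_inv hAm
  have hPinv := aestronglyMeasurable_inv (N := 𝒯.projMat A) (μ := volume.restrict Ω)
    fun i j => 𝒯.aestronglyMeasurable_proj (fun y => A y i j) _
  have hbs : AEStronglyMeasurable (bStar A b) (volume.restrict Ω) :=
    aestronglyMeasurable_mulE hAinv hbm
  have hbsH : AEStronglyMeasurable (𝒯.bStarH A b) (volume.restrict Ω) :=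
    aestronglyMeasurable_mulE hPinv (𝒯.aestronglyMeasurable_proj b _)
  have hflux : AEStronglyMeasurable (flux A b u gu) (volume.restrict Ω) :=
    ((aestronglyMeasurable_mulE hAm hu.grad_memL2.1).add (hu.memL2.1.smul hbm)).neg
  set X₁ : Plane → Plane := fun x => mulE ((A x)⁻¹ - (𝒯.projMat A x)⁻¹) (pM x) with hX₁
  set X₂ : Plane → Plane := fun x => mulE (A x)⁻¹ ((flux A b u gu - pM) x) with hX₂
  set X₃ : Plane → Plane := fun x => uM x • (bStar A b x - 𝒯.bStarH A b x) with hX₃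
  set X₄ : Plane → Plane := fun x => (u - uM) x • bStar A b x with hX₄
  have m₁ : AEStronglyMeasurable X₁ (volume.restrict Ω) :=
    aestronglyMeasurable_mulE (fun i j => (hAinv i j).sub (hPinv i j)) hp.1
  have m₂ : AEStronglyMeasurable X₂ (volume.restrict Ω) :=
    aestronglyMeasurable_mulE hAinv (hflux.sub hp.1)
  have m₃ : AEStronglyMeasurable X₃ (volume.restrict Ω) := huM.1.smul (hbs.sub hbsH)
  have m₄ : AEStronglyMeasurable X₄ (volume.restrict Ω) := (hu.memL2.1.sub huM.1).smul hbs
  have hsplit : l2norm Ω (𝒯.residualField A b pM uM + gu) = l2norm Ω (X₁ + X₂ + X₃ + X₄) := by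
    refine eLpNorm_congr_norm_ae ?_
    filter_upwards [hA.lower] with x hx
    have hgu : mulE (A x)⁻¹ (flux A b u gu x) = -(gu x + u x • bStar A b x) := by
      rw [flux, mulE_neg, mulE_add, mulE_mulE, mulE_smul,
        Matrix.nonsing_inv_mul _ (isUnit_det_of_coercive ha hx), one_mulE, bStar]
    -- `X₁ + X₂ + X₃ + X₄` is minus the field on the left.
    rw [← norm_neg]
    congr 1
    simp only [Pi.add_apply, hX₁, hX₂, hX₃, hX₄, Pi.sub_apply, mulE_sub, sub_mulE, hgu,
      Triangulation.residualField, sub_smul, smul_sub]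
    abel
  have b₂ : l2norm Ω X₂ ≤ Real.toNNReal a⁻¹ * l2norm Ω (flux A b u gu - pM) := by
    refine eLpNorm_le_mul_eLpNorm_of_ae_le_mul ?_ 2
    filter_upwards [hA.lower] with x hx
    exact norm_inv_mulE_le ha hx _
  have b₄ : l2norm Ω X₄ ≤ Real.toNNReal (a⁻¹ * |β|) * l2norm Ω (u - uM) := by
    refine eLpNorm_le_mul_eLpNorm_of_ae_le_mul ?_ 2
    filter_upwards [hA.lower, ae_restrict_mem hΩ.measurableSet] with x hx hxΩ
    simp only [hX₄, norm_smul]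
    rw [mul_comm]
    gcongr
    refine (norm_inv_mulE_le ha hx _).trans ?_
    gcongr
    exact (hb x hxΩ).trans (le_abs_self β)
  rw [hsplit]
  calc l2norm Ω (X₁ + X₂ + X₃ + X₄) ≤ l2norm Ω X₁ + l2norm Ω X₂ + l2norm Ω X₃ + l2norm Ω X₄ :=
        (l2norm_add_le ((m₁.add m₂).add m₃) m₄).trans (add_le_add_left
          ((l2norm_add_le (m₁.add m₂) m₃).trans (add_le_add_left (l2norm_add_le m₁ m₂) _)) _)
    _ ≤ l2norm Ω X₁ + Real.toNNReal a⁻¹ * l2norm Ω (flux A b u gu - pM) + l2norm Ω X₃ +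
        Real.toNNReal (a⁻¹ * |β|) * l2norm Ω (u - uM) := by gcongr
    _ ≤ _ := by
      push_cast
      set Q := l2norm Ω (u - uM) + l2norm Ω (flux A b u gu - pM) + l2norm Ω X₁ + l2norm Ω X₃
      have q₁ : l2norm Ω X₁ + l2norm Ω X₃ ≤ Q := by
        rw [show Q = l2norm Ω (u - uM) + l2norm Ω (flux A b u gu - pM) +
          (l2norm Ω X₁ + l2norm Ω X₃) from add_assoc _ _ _]
        exact le_add_self
      have q₂ : l2norm Ω (flux A b u gu - pM) ≤ Q :=
        le_add_self.trans (le_self_add.trans le_self_add)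
      have q₃ : l2norm Ω (u - uM) ≤ Q := le_self_add.trans (le_self_add.trans le_self_add)
      calc _ = (l2norm Ω X₁ + l2norm Ω X₃) +
            Real.toNNReal a⁻¹ * l2norm Ω (flux A b u gu - pM) +
            Real.toNNReal (a⁻¹ * |β|) * l2norm Ω (u - uM) := by ring
        _ ≤ Q + Real.toNNReal a⁻¹ * Q + Real.toNNReal (a⁻¹ * |β|) * Q := by gcongr
        _ = _ := by ring

end MixedFEM

open MixedFEM
theorem mainTheorem7 (Ω : Set Plane) (hΩ : IsPolygonalLipschitzDomain Ω)
    (κ a β : ℝ) (hκ : 0 < κ) (ha : 0 < a) :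
    ∃ C : ℝ≥0, ∀ (A : Plane → Matrix (Fin 2) (Fin 2) ℝ) (b : Plane → Plane) (γ : Plane → ℝ)
      (L : ℝ), CoeffAssumption Ω A b γ a L → (∀ x ∈ Ω, ‖b x‖ ≤ β) → WellPosed Ω A b γ →
      ∀ f : Plane → ℝ, MemL2 Ω f →
      ∀ (u : Plane → ℝ) (gu : Plane → Plane), IsWeakSolution Ω A b γ f u gu →
      ∀ 𝒯 : Triangulation Ω, 𝒯.ShapeRegular κ →
      ∀ (pM : Plane → Plane) (uM : Plane → ℝ), 𝒯.IsMixedSolution A b γ f pM uM →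
      ∃ (v : Plane → ℝ) (gv : Plane → Plane), MemH10 Ω v gv ∧
        (∀ w gw, MemH10 Ω w gw →
          l2norm Ω (𝒯.residualField A b pM uM - gv) ≤
            l2norm Ω (𝒯.residualField A b pM uM - gw)) ∧
        l2norm Ω (𝒯.residualField A b pM uM - gv) +
            l2norm Ω (fun x => 𝒯.meshSize x • 𝒯.residualField A b pM uM x) ≤
          C * (l2norm Ω (u - uM) + l2norm Ω (flux A b u gu - pM) +
            l2norm Ω (fun x => mulE ((A x)⁻¹ - (𝒯.projMat A x)⁻¹) (pM x)) +
            l2norm Ω (fun x => uM x • (bStar A b x - 𝒯.bStarH A b x))) := by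
  obtain ⟨C₁, hC₁⟩ := exists_meshSize_estimate hΩ hκ
  set C₂ : ℝ≥0 := 1 + Real.toNNReal a⁻¹ + Real.toNNReal (a⁻¹ * |β|)
  refine ⟨C₂ + C₁ * (C₂ + 1), ?_⟩
  intro A b γ L hA hb _ f _ u gu hu 𝒯 h𝒯 pM uM hM
  set r := 𝒯.residualField A b pM uM
  have haff := fun T (hT : T ∈ 𝒯.triangles) =>
    𝒯.exists_residualField_eq_affine A b hM.memRT0 hM.memP0 hT
  have hrL2 : MemL2 Ω r := 𝒯.memL2_of_piecewise_continuous hΩ fun T hT => by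
    obtain ⟨p, M, h⟩ := haff T hT
    exact ⟨fun x => p + M x, continuous_const.add M.continuous, h⟩
  obtain ⟨v, gv, hv, hmin⟩ := exists_minimizer_memH10 hΩ.bounded hrL2
  refine ⟨v, gv, hv, hmin, ?_⟩
  have huM : MemL2 Ω uM := by
    obtain ⟨k, hk⟩ := hM.memP0
    exact 𝒯.memL2_of_piecewise_continuous hΩ fun T hT => ⟨fun _ => k T, continuous_const,
      ae_restrict_of_ae_restrict_of_subset interior_subset (hk T hT)⟩
  have hE := l2norm_residualField_add_le hΩ.isOpen hA hb hu.mem.memH1 𝒯 hM.memRT0.1.1 huM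
  -- The competitor `-u` bounds the minimum.
  have h1 := hmin _ _ hu.mem.neg
  rw [sub_neg_eq_add] at h1
  have h2 := hC₁ 𝒯 h𝒯 u gu hu.mem.memH1 uM hM.memP0 _ haff
  set Q := l2norm Ω (u - uM) + l2norm Ω (flux A b u gu - pM) +
    l2norm Ω (fun x => mulE ((A x)⁻¹ - (𝒯.projMat A x)⁻¹) (pM x)) +
    l2norm Ω (fun x => uM x • (bStar A b x - 𝒯.bStarH A b x))
  have hU : l2norm Ω (u - uM) ≤ Q := le_self_add.trans (le_self_add.trans le_self_add)
  calc _ ≤ C₂ * Q + C₁ * (C₂ * Q + Q) :=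
        add_le_add (h1.trans hE) (h2.trans (by gcongr))
    _ = _ := by
      push_cast
      ring
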